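/- Let $\mathcal{C}$ be an essentially small triangulated category with Grothendieck group $K(\mathcal{C})$. Write $\langle S\rangle$ for the extension-closed strict full subcategory generated by $S$. A stability condition $\sigma=(\mathcal{Z}_\sigma,\mathcal{P}_\sigma)$ consists of a homomorphism $\mathcal{Z}_\sigma:K(\mathcal{C})\to\mathbb{C}$ and strict full additive subcategories $\mathcal{P}_\sigma(\varphi)$, $\varphi\in\mathbb{R}$, such that: (1) if $0\neq c\in\mathcal{P}_\sigma(\varphi)$ then $\mathcal{Z}_\sigma(c)=m(c)e^{i\pi\varphi}$ with $m(c)>0$; (2) $\mathcal{P}_\sigma(\varphi+1)=\mathcal{P}_\sigma(\varphi)[1]$; (3) $\mathrm{Hom}(c,c')=0$ for $c\in\mathcal{P}_\sigma(\varphi)$, $c'\in\mathcal{P}_\sigma(\varphi')$ with $\varphi>\varphi'$; (4) every $c\neq0$ has a Harder–Narasimhan filtration, i.e. a finite sequence of maps $0=c_0\to c_1\to\cdots\to c_n=c$ whose cones $b_j$ (of $c_{j-1}\to c_j$) are nonzero objects of $\mathcal{P}_\sigma(\varphi_j)$ with $\varphi_1>\cdots>\varphi_n$. Put $\varphi^+_\sigma(c)=\varphi_1$,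 $\varphi^-_\sigma(c)=\varphi_n$, $m_\sigma(c)=\sum_j m(b_j)$, and $\mathcal{P}_\sigma(I)=\langle\mathcal{P}_\sigma(\varphi)\mid\varphi\in I\rangle$ for an interval $I$. The heart of $\sigma$ is $\mathcal{A}_\sigma=\mathcal{P}_\sigma(0,1]$. Let $\mathrm{Stab}(\mathcal{C})$ be the set of locally-finite stability conditions, i.e. those for which each $t\in\mathbb{R}$ has an $\epsilon\in(0,\tfrac12)$ such that the quasi-abelian category $\mathcal{P}_\sigma(t-\epsilon,t+\epsilon)$ is artinian and noetherian with respect to strict subobjects, with the topology given by the generalised metric $$d(\sigma,\tau)=\sup_{0\neq c\in\mathcal{C}}\max\left\{|\varphi^-_\sigma(c)-\varphi^-_\tau(c)|,\ |\varphi^+_\sigma(c)-\varphi^+_\tau(c)|,\ \left|\log\frac{m_\sigma(c)}{m_\tau(c)}\right|\right\}\in[0,\infty].$$ A t-structure is identified with its aisle $\mathcal{D}$, so that its heart is $\mathcal{A}=\mathcal{D}\cap\mathcal{D}^\perp[1]$. A torsion theory in the abelian category $\mathcal{A}$ is a pair $(\mathcal{T},\mathcal{F})$ of strict full subcategories of $\mathcal{A}$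 such that $\mathrm{Hom}(\mathcal{T},\mathcal{F})=0$ and every $a\in\mathcal{A}$ sits in a short exact sequence $0\to t\to a\to f\to0$ in $\mathcal{A}$ with $t\in\mathcal{T}$, $f\in\mathcal{F}$. The left tilt of $\mathcal{D}$ at $(\mathcal{T},\mathcal{F})$ is the t-structure $\langle\mathcal{D},\mathcal{T}[-1]\rangle$; the right tilt is its shift $\langle\mathcal{D},\mathcal{T}[-1]\rangle[1]$. Their hearts are called the left and the right tilt of $\mathcal{A}$. If $\sigma$ and $\tau$ lie in the same connected component of $\mathrm{Stab}(\mathcal{C})$, then the hearts $\mathcal{A}_\sigma$ and $\mathcal{A}_\tau$ are related by a finite sequence of left and right tilts at torsion theories. More precisely, $\mathcal{P}_\sigma(0,\infty)$ and $\mathcal{P}_\tau(0,\infty)$ are t-structures with hearts $\mathcal{A}_\sigma$ and $\mathcal{A}_\tau$, and the second is obtained from the first by a finite (possibly empty) sequence of left and right tilts, each at a torsion theory in the heart of the t-structure reached so far. -/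

import Mathlib

open CategoryTheory CategoryTheory.Limits CategoryTheory.Pretriangulated
open CategoryTheory.Triangulated
open scoped ENNReal

universe v u

noncomputable section

namespace Bridgeland

variable {C : Type u} [Category.{v} C] [Preadditive C] [HasZeroObject C] [HasShift C ℤ]
  [∀ n : ℤ, (shiftFunctor C n).Additive] [Pretriangulated C]

/-! ### Extension closures -/

/-- `extClosure S` is the (strict, full) extension-closed subcategory generated by the objects
satisfying `S`: it contains every object isomorphic to one in `S`, and if `X → Y → Z → X⟦1⟧` is an
exact triangle with `X` and `Z` in it, then `Y` is in it. -/
inductive extClosure (S : ObjectProperty C) : ObjectProperty C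
  | of (X : C) (hX : S X) : extClosure S X
  | iso (X Y : C) (e : X ≅ Y) (hX : extClosure S X) : extClosure S Y
  | ext (X Y Z : C) (f : X ⟶ Y) (g : Y ⟶ Z) (h : Z ⟶ X⟦(1 : ℤ)⟧)
      (hT : Triangle.mk f g h ∈ distTriang C) (hX : extClosure S X) (hZ : extClosure S Z) :
      extClosure S Y

/-! ### The Grothendieck group -/

variable (C) in
/-- The subgroup of the free abelian group on the objects of `C` generated by the elements
`[Y] - [X] - [Z]`, for all exact triangles `X → Y → Z → X⟦1⟧`. -/
def triangleRelations : AddSubgroup (FreeAbelianGroup C) :=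
  AddSubgroup.closure
    {x | ∃ T : Triangle C, T ∈ distTriang C ∧
      x = FreeAbelianGroup.of T.obj₂ - FreeAbelianGroup.of T.obj₁ - FreeAbelianGroup.of T.obj₃}

variable (C) in
/-- The Grothendieck group of the triangulated category `C`. -/
abbrev GrothendieckGroup : Type u := FreeAbelianGroup C ⧸ triangleRelations C

/-- The class of an object in the Grothendieck group. -/
def GrothendieckGroup.mk (X : C) : GrothendieckGroup C :=
  QuotientAddGroup.mk (FreeAbelianGroup.of X)

/-! ### Stability conditions -/

/-- A Harder--Narasimhan filtration of `c` with respect to the subcategories `P φ`: a chain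
`0 = obj 0 → obj 1 → ⋯ → obj (n + 1) ≅ c` with exact triangles
`obj i → obj (i + 1) → factor i → (obj i)⟦1⟧`, where the factors `factor 0, …, factor n` are
nonzero objects of `P (phase 0), …, P (phase n)` and `phase 0 > ⋯ > phase n`. -/
structure HNFiltration (P : ℝ → ObjectProperty C) (c : C) where
  /-- one less than the number of factors -/
  n : ℕ
  obj : Fin (n + 2) → C
  factor : Fin (n + 1) → C
  phase : Fin (n + 1) → ℝ
  f (i : Fin (n + 1)) : obj i.castSucc ⟶ obj i.succ
  g (i : Fin (n + 1)) : obj i.succ ⟶ factor i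
  h (i : Fin (n + 1)) : factor i ⟶ (obj i.castSucc)⟦(1 : ℤ)⟧
  isZero_obj_zero : IsZero (obj 0)
  isoLast : obj (Fin.last (n + 1)) ≅ c
  triangle (i : Fin (n + 1)) : Triangle.mk (f i) (g i) (h i) ∈ distTriang C
  mem (i : Fin (n + 1)) : P (phase i) (factor i)
  factor_nonzero (i : Fin (n + 1)) : ¬ IsZero (factor i)
  strictAnti : StrictAnti phase

variable (C) in
/-- A stability condition on the triangulated category `C`. -/
structure StabilityCondition where
  /-- the central charge -/
  Z : GrothendieckGroup C →+ ℂ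
  /-- `P φ` is the subcategory of semistable objects of phase `φ` -/
  P : ℝ → ObjectProperty C
  isClosedUnderIsomorphisms (φ : ℝ) : (P φ).IsClosedUnderIsomorphisms
  isClosedUnderFiniteProducts (φ : ℝ) : (P φ).IsClosedUnderFiniteProducts
  exists_mass (φ : ℝ) (c : C) (hc : P φ c) (hc0 : ¬ IsZero c) :
    ∃ m : ℝ, 0 < m ∧ Z (GrothendieckGroup.mk c) = m * Complex.exp (Complex.I * Real.pi * φ)
  /-- `P (φ + 1) = (P φ)[1]` -/
  shift_iff (φ : ℝ) (c : C) : P (φ + 1) c ↔ P φ (c⟦(-1 : ℤ)⟧)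
  hom_eq_zero (φ φ' : ℝ) (hφ : φ' < φ) (c c' : C) (hc : P φ c) (hc' : P φ' c') (f : c ⟶ c') :
    f = 0
  exists_hn (c : C) (hc : ¬ IsZero c) : Nonempty (HNFiltration P c)

namespace StabilityCondition

variable (σ : StabilityCondition C)

/-- A Harder--Narasimhan filtration of a nonzero object (they are unique up to isomorphism, so
that the choice does not matter). -/
def hn (c : C) (hc : ¬ IsZero c) : HNFiltration σ.P c := (σ.exists_hn c hc).some

/-- The maximal phase `φ⁺(c)`. -/
def phiPlus (c : C) (hc : ¬ IsZero c) : ℝ := (σ.hn c hc).phase 0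

/-- The minimal phase `φ⁻(c)`. -/
def phiMinus (c : C) (hc : ¬ IsZero c) : ℝ := (σ.hn c hc).phase (Fin.last _)

/-- The mass of a nonzero object: the sum of the `m(b) = |Z(b)|` over its semistable factors
`b`. -/
def mass (c : C) (hc : ¬ IsZero c) : ℝ :=
  ∑ i, ‖σ.Z (GrothendieckGroup.mk ((σ.hn c hc).factor i))‖

lemma mass_pos (c : C) (hc : ¬ IsZero c) : 0 < σ.mass c hc := by
  refine Finset.sum_pos (fun i _ => ?_) Finset.univ_nonempty
  obtain ⟨m, hm, h⟩ := σ.exists_mass _ _ ((σ.hn c hc).mem i) ((σ.hn c hc).factor_nonzero i)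
  rw [h, norm_pos_iff]
  exact mul_ne_zero (by exact_mod_cast hm.ne') (Complex.exp_ne_zero _)

/-- `P(I)`, the extension-closed subcategory generated by the semistable objects with phase in
`I`. -/
def interval (I : Set ℝ) : ObjectProperty C :=
  extClosure (fun c => ∃ φ ∈ I, σ.P φ c)

/-- The heart `P((0, 1])` of a stability condition. -/
def heart : ObjectProperty C := σ.interval (Set.Ioc 0 1)

end StabilityCondition

/-- A subobject is strict if its inclusion is the kernel of some morphism. -/
def IsStrictSubobject {D : Type*} [Category* D] [Preadditive D] {X : D} (S : Subobject X) : Prop :=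
  Nonempty (NormalMono S.arrow)

/-- Every object satisfies the descending and the ascending chain condition on strict
subobjects. -/
def IsArtinianAndNoetherian (D : Type*) [Category* D] [Preadditive D] : Prop :=
  ∀ X : D, WellFoundedLT {S : Subobject X // IsStrictSubobject S} ∧
    WellFoundedGT {S : Subobject X // IsStrictSubobject S}

/-- A stability condition is locally finite if every `t` has an `ε > 0` such that the category
`P((t - ε, t + ε))` is artinian and noetherian; as this category has to be quasi-abelian, the
interval is to have length `2 ε < 1`. -/
def StabilityCondition.IsLocallyFinite (σ : StabilityCondition C) : Prop :=
  ∀ t : ℝ, ∃ ε : ℝ, 0 < ε ∧ 2 * ε < 1 ∧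
    IsArtinianAndNoetherian (σ.interval (Set.Ioo (t - ε) (t + ε))).FullSubcategory

/-! ### The space of stability conditions -/

variable (C) in
/-- The set of locally finite stability conditions on `C`. -/
def Stab := {σ : StabilityCondition C // σ.IsLocallyFinite}

/-- The quantity whose supremum over the nonzero objects `c` is the distance of `σ` and `τ`. -/
def distAt (σ τ : StabilityCondition C) (c : C) (hc : ¬ IsZero c) : ℝ :=
  max (max |σ.phiMinus c hc - τ.phiMinus c hc| |σ.phiPlus c hc - τ.phiPlus c hc|)
    |Real.log (σ.mass c hc / τ.mass c hc)|

/-- The generalised metric, with values in `[0, ∞]`. -/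
def genDist (σ τ : StabilityCondition C) : ℝ≥0∞ :=
  ⨆ (c : C) (hc : ¬ IsZero c), ENNReal.ofReal (distAt σ τ c hc)

lemma distAt_nonneg (σ τ : StabilityCondition C) (c : C) (hc : ¬ IsZero c) :
    0 ≤ distAt σ τ c hc :=
  le_max_of_le_right (abs_nonneg _)

lemma distAt_self (σ : StabilityCondition C) (c : C) (hc : ¬ IsZero c) :
    distAt σ σ c hc = 0 := by
  simp [distAt, (σ.mass_pos c hc).ne']

lemma log_mass_div (σ τ : StabilityCondition C) (c : C) (hc : ¬ IsZero c) :
    Real.log (σ.mass c hc / τ.mass c hc) =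
      Real.log (σ.mass c hc) - Real.log (τ.mass c hc) :=
  Real.log_div (σ.mass_pos c hc).ne' (τ.mass_pos c hc).ne'

lemma distAt_comm (σ τ : StabilityCondition C) (c : C) (hc : ¬ IsZero c) :
    distAt σ τ c hc = distAt τ σ c hc := by
  simp only [distAt, log_mass_div]
  rw [abs_sub_comm, abs_sub_comm (σ.phiPlus c hc), abs_sub_comm (Real.log (σ.mass c hc))]

lemma distAt_triangle (σ τ υ : StabilityCondition C) (c : C) (hc : ¬ IsZero c) :
    distAt σ υ c hc ≤ distAt σ τ c hc + distAt τ υ c hc := by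
  simp only [distAt, log_mass_div]
  refine max_le (max_le ?_ ?_) ?_
  · exact (abs_sub_le _ (τ.phiMinus c hc) _).trans
      (add_le_add ((le_max_left _ _).trans (le_max_left _ _))
        ((le_max_left _ _).trans (le_max_left _ _)))
  · exact (abs_sub_le _ (τ.phiPlus c hc) _).trans
      (add_le_add ((le_max_right _ _).trans (le_max_left _ _))
        ((le_max_right _ _).trans (le_max_left _ _)))
  · exact (abs_sub_le _ (Real.log (τ.mass c hc)) _).trans
      (add_le_add (le_max_right _ _) (le_max_right _ _))

/-- The generalised metric on the space of stability conditions, and the topology it induces. -/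
instance : PseudoEMetricSpace (Stab C) where
  edist σ τ := genDist σ.1 τ.1
  edist_self σ := by simp [genDist, distAt_self]
  edist_comm σ τ := by simp only [genDist, distAt_comm σ.1 τ.1]
  edist_triangle σ τ υ := by
    refine iSup₂_le fun c hc => ?_
    refine (ENNReal.ofReal_le_ofReal (distAt_triangle σ.1 τ.1 υ.1 c hc)).trans ?_
    rw [ENNReal.ofReal_add (distAt_nonneg _ _ _ _) (distAt_nonneg _ _ _ _)]
    exact add_le_add
      (le_iSup₂ (f := fun c hc => ENNReal.ofReal (distAt σ.1 τ.1 c hc)) c hc)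
      (le_iSup₂ (f := fun c hc => ENNReal.ofReal (distAt τ.1 υ.1 c hc)) c hc)

/-! ### Torsion theories and tilting -/

/-- A torsion theory `(T, F)` in the heart `A` (a full subcategory of `C`): `T` and `F` are strict
full subcategories of `A`, all morphisms from `T` to `F` vanish, and each object `a` of `A` sits in
a short exact sequence `0 → x → a → y → 0` of `A` with `x` in `T` and `y` in `F`. -/
structure IsTorsionTheory (A T F : ObjectProperty C) : Prop where
  torsion_le : T ≤ A
  free_le : F ≤ A
  torsion_iso : T.IsClosedUnderIsomorphisms
  free_iso : F.IsClosedUnderIsomorphisms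
  hom_eq_zero (x y : C) (hx : T x) (hy : F y) (f : x ⟶ y) : f = 0
  exists_shortExact (a : A.FullSubcategory) :
    ∃ (x y : A.FullSubcategory) (i : x ⟶ a) (p : a ⟶ y) (w : i ≫ p = 0),
      T x.obj ∧ F y.obj ∧ (ShortComplex.mk i p w).ShortExact

/-- The t-structure `t` is obtained from the t-structure `s` by left tilting at the torsion theory
`(T, F)` in the heart of `s`: with `D = s.le 0`, the aisle of `t` is `⟨D, T[-1]⟩`. (An object is in
`T[-1]` when its shift by `1` is in `T`.) -/
def IsLeftTilt (s t : TStructure C) : Prop :=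
  ∃ T F : ObjectProperty C, IsTorsionTheory s.heart T F ∧
    t.le 0 = extClosure (s.le 0 ⊔ T.shift (1 : ℤ))

/-- The t-structure `t` is obtained from the t-structure `s` by right tilting at the torsion theory
`(T, F)` in the heart of `s`: its aisle is the shift by `[1]` of the aisle `⟨D, T[-1]⟩` of the left
tilt at `(T, F)`. -/
def IsRightTilt (s t : TStructure C) : Prop :=
  ∃ T F : ObjectProperty C, IsTorsionTheory s.heart T F ∧
    t.le 0 = (extClosure (s.le 0 ⊔ T.shift (1 : ℤ))).shift (-1 : ℤ)

end Bridgeland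

end

noncomputable section

namespace Bridgeland

open scoped ZeroObject

variable {C : Type u} [Category.{v} C] [Preadditive C] [HasZeroObject C] [HasShift C ℤ]
  [∀ n : ℤ, (shiftFunctor C n).Additive] [Pretriangulated C]

/-! ### Exactness of distinguished triangles -/

section Exactness

variable {X Y Z W : C} {f : X ⟶ Y} {g : Y ⟶ Z} {h : Z ⟶ X⟦(1 : ℤ)⟧}

/-! Tilting is governed by nested aisles. If D ⊆ E ⊆ D[-1] are aisles of t-structures, then E is the
left tilt of D at the torsion theory whose torsion part is the heart of D intersected with E[1]
(`isLeftTilt_of_le`), and E[1] is a right tilt of D (`isRightTilt_of_le`).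

A stability condition gives aisles P(a, ∞) for all real a, by truncating Harder–Narasimhan
filtrations (`tStructure`). If d(σ, τ) ≤ 1/2, minimal phases move by at most 1/2, hence P_σ(-1/2, ∞)
⊆ P_τ(-1, ∞) ⊆ P_σ(-3/2, ∞). So P_τ(0, ∞) is a right tilt of P_σ(-1/2, ∞), which is a left tilt of
P_σ(0, ∞). The set of stability conditions reachable from σ by tilts is then open and closed, and
contains the connected component of σ. -/

lemma exists_comp_mor₁_of_distTriang (hT : Triangle.mk f g h ∈ distTriang C) (k : W ⟶ Y)
    (hk : k ≫ g = 0) : ∃ l : W ⟶ X, k = l ≫ f :=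
  Triangle.coyoneda_exact₂ _ hT k hk

lemma exists_mor₂_comp_of_distTriang (hT : Triangle.mk f g h ∈ distTriang C) (k : Y ⟶ W)
    (hk : f ≫ k = 0) : ∃ l : Z ⟶ W, k = g ≫ l :=
  Triangle.yoneda_exact₂ _ hT k hk

lemma exists_mor₃_comp_of_distTriang (hT : Triangle.mk f g h ∈ distTriang C) (k : Z ⟶ W)
    (hk : g ≫ k = 0) : ∃ l : X⟦(1 : ℤ)⟧ ⟶ W, k = h ≫ l :=
  Triangle.yoneda_exact₃ _ hT k hk

lemma exists_comp_mor₃_of_distTriang (hT : Triangle.mk f g h ∈ distTriang C)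
    (k : W ⟶ X⟦(1 : ℤ)⟧) (hk : k ≫ f⟦(1 : ℤ)⟧' = 0) : ∃ l : W ⟶ Z, k = l ≫ h :=
  Triangle.coyoneda_exact₁ _ hT k hk

lemma exists_comp_shift_of_distTriang (hT : Triangle.mk f g h ∈ distTriang C) (k : W ⟶ X)
    (hk : k ≫ f = 0) : ∃ (l : W ⟶ Z⟦(-1 : ℤ)⟧) (m : Z⟦(-1 : ℤ)⟧ ⟶ X), k = l ≫ m := by
  obtain ⟨l, hl⟩ := Triangle.coyoneda_exact₂ _ (inv_rot_of_distTriang _ hT) k hk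
  exact ⟨l, _, hl⟩

end Exactness

/-! ### Extension closures -/

instance (S : ObjectProperty C) : (extClosure S).IsClosedUnderIsomorphisms where
  of_iso e h := .iso _ _ e h

lemma extClosure_le {S P : ObjectProperty C} [P.IsClosedUnderIsomorphisms] (hS : S ≤ P)
    (hP : ∀ T ∈ distTriang C, P T.obj₁ → P T.obj₃ → P T.obj₂) : extClosure S ≤ P := by
  intro X hX
  induction hX with
  | of X hX => exact hS _ hX
  | iso X Y e _ ih => exact P.prop_of_iso e ih
  | ext X Y Z f g h hT _ _ ihX ihZ => exact hP _ hT ihX ihZ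

lemma extClosure_obj₂ {S : ObjectProperty C} (T : Triangle C) (hT : T ∈ distTriang C)
    (h₁ : extClosure S T.obj₁) (h₃ : extClosure S T.obj₃) : extClosure S T.obj₂ :=
  .ext _ _ _ T.mor₁ T.mor₂ T.mor₃ hT h₁ h₃

lemma extClosure_mono {S T : ObjectProperty C} (h : S ≤ T) : extClosure S ≤ extClosure T :=
  extClosure_le (fun X hX => .of X (h X hX)) extClosure_obj₂

/-- Orthogonality survives extensions in each variable, by exactness of Hom on triangles: first
induct on the target for a fixed generator as source, then on the source. -/
lemma extClosure_hom_eq_zero {S T : ObjectProperty C}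
    (h : ∀ ⦃X Y : C⦄, S X → T Y → ∀ f : X ⟶ Y, f = 0) {X Y : C}
    (hX : extClosure S X) (hY : extClosure T Y) (f : X ⟶ Y) : f = 0 := by
  have key : ∀ {X : C}, S X → ∀ f : X ⟶ Y, f = 0 := by
    intro X hX
    clear f
    induction hY with
    | of Y hY => exact h hX hY
    | iso Y Y' e _ ih =>
      intro f
      rw [← cancel_mono e.inv, zero_comp]
      exact ih (f ≫ e.inv)
    | ext A B D a b c hT _ _ ihA ihD =>
      intro f
      obtain ⟨g, hg⟩ := exists_comp_mor₁_of_distTriang hT f (ihD (f ≫ b))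
      rw [hg, ihA g, zero_comp]
  induction hX with
  | of X hX => exact key hX f
  | iso X X' e _ ih =>
    rw [← cancel_epi e.hom, comp_zero]
    exact ih _
  | ext A B D a b c hT _ _ ihA ihD =>
    obtain ⟨g, hg⟩ := exists_mor₂_comp_of_distTriang hT f (ihA _)
    rw [hg, ihD g, comp_zero]

lemma extClosure_shift {S T : ObjectProperty C} (n : ℤ)
    (h : ∀ X, S X → extClosure T (X⟦n⟧)) {X : C} (hX : extClosure S X) :
    extClosure T (X⟦n⟧) := by
  induction hX with
  | of X hX => exact h X hX
  | iso X Y e _ ih => exact .iso _ _ ((shiftFunctor C n).mapIso e) ih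
  | ext X Y Z f g h hT _ _ ihX ihZ =>
    exact extClosure_obj₂ _ (Triangle.shift_distinguished _ hT n) ihX ihZ

/-! ### Intervals of phases -/

namespace StabilityCondition

variable (σ : StabilityCondition C)

lemma P_of_isZero (φ : ℝ) {X : C} (hX : IsZero X) : σ.P φ X := by
  have := σ.isClosedUnderIsomorphisms φ
  have := σ.isClosedUnderFiniteProducts φ
  exact (σ.P φ).prop_of_isTerminal X hX.isTerminal

lemma P_shift (n : ℤ) {φ : ℝ} {X : C} (hX : σ.P φ X) : σ.P (φ + n) (X⟦n⟧) := by
  have := σ.isClosedUnderIsomorphisms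
  induction n using Int.induction_on with
  | zero => simpa using (σ.P φ).prop_of_iso ((shiftFunctorZero C ℤ).app X).symm hX
  | succ n ih =>
    have h : φ + ((n + 1 : ℤ) : ℝ) = (φ + (n : ℤ)) + 1 := by push_cast; ring
    rw [h, σ.shift_iff]
    exact (σ.P _).prop_of_iso ((shiftFunctorAdd' C ((n : ℤ) + 1) (-1) n (by lia)).app X) ih
  | pred n ih =>
    have h : φ + ((-n : ℤ) : ℝ) = (φ + ((-n - 1 : ℤ) : ℝ)) + 1 := by push_cast; ring
    rw [h, σ.shift_iff] at ih
    exact (σ.P _).prop_of_iso ((shiftFunctorAdd' C (-(n : ℤ)) (-1) (-n - 1) (by lia)).app X).symm ih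

variable {σ} {I J : Set ℝ}

instance : (σ.interval I).IsClosedUnderIsomorphisms := by
  unfold interval
  infer_instance

lemma interval_of_P {φ : ℝ} (hφ : φ ∈ I) {X : C} (hX : σ.P φ X) : σ.interval I X :=
  .of X ⟨φ, hφ, hX⟩

lemma interval_of_isZero (hI : I.Nonempty) {X : C} (hX : IsZero X) : σ.interval I X :=
  interval_of_P hI.some_mem (σ.P_of_isZero _ hX)

lemma interval_obj₂ (T : Triangle C) (hT : T ∈ distTriang C)
    (h₁ : σ.interval I T.obj₁) (h₃ : σ.interval I T.obj₃) : σ.interval I T.obj₂ :=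
  extClosure_obj₂ T hT h₁ h₃

lemma interval_mono (h : I ⊆ J) : σ.interval I ≤ σ.interval J :=
  extClosure_mono fun _ ⟨φ, hφ, hX⟩ => ⟨φ, h hφ, hX⟩

lemma interval_hom_eq_zero (h : ∀ a ∈ I, ∀ b ∈ J, b < a) {X Y : C}
    (hX : σ.interval I X) (hY : σ.interval J Y) (f : X ⟶ Y) : f = 0 :=
  extClosure_hom_eq_zero
    (fun _ _ ⟨_, ha, hX⟩ ⟨_, hb, hY⟩ f => σ.hom_eq_zero _ _ (h _ ha _ hb) _ _ hX hY f) hX hY f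

lemma interval_shift (n : ℤ) (h : ∀ φ ∈ I, φ + n ∈ J) {X : C} (hX : σ.interval I X) :
    σ.interval J (X⟦n⟧) :=
  extClosure_shift n (fun _ ⟨_, hφ, hX⟩ => interval_of_P (h _ hφ) (σ.P_shift n hX)) hX

end StabilityCondition

/-! ### Truncation along Harder--Narasimhan filtrations -/

namespace HNFiltration

variable {σ : StabilityCondition C} {c : C} (F : HNFiltration σ.P c) {I : Set ℝ}

lemma obj_mem (hI : I.Nonempty) (j : Fin (F.n + 2))
    (hj : ∀ i : Fin (F.n + 1), i.castSucc < j → F.phase i ∈ I) : σ.interval I (F.obj j) := by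
  induction j using Fin.induction with
  | zero => exact StabilityCondition.interval_of_isZero hI F.isZero_obj_zero
  | succ j ih =>
    exact StabilityCondition.interval_obj₂ _ (F.triangle j)
      (ih fun i hi => hj i (hi.trans Fin.castSucc_lt_succ))
      (StabilityCondition.interval_of_P (hj j Fin.castSucc_lt_succ) (F.mem j))

lemma interval_of_phase_mem (hI : ∀ i, F.phase i ∈ I) : σ.interval I c :=
  (σ.interval I).prop_of_iso F.isoLast (F.obj_mem ⟨_, hI 0⟩ _ fun i _ => hI i)

/-- The phases of the Harder--Narasimhan factors of an object of `P((a, ∞))` exceed `a`. -/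
lemma lt_phase {a : ℝ} (hc : σ.interval (Set.Ioi a) c) (i : Fin (F.n + 1)) : a < F.phase i := by
  refine lt_of_lt_of_le ?_ (F.strictAnti.antitone (Fin.le_last i))
  by_contra! hle
  let l := Fin.last F.n
  have hg : F.g l = 0 := by
    refine StabilityCondition.interval_hom_eq_zero (I := Set.Ioi a) (J := Set.Iic a)
      (fun _ hx _ hy => lt_of_le_of_lt hy hx)
      ((σ.interval _).prop_of_iso F.isoLast.symm hc)
      (StabilityCondition.interval_of_P (Set.mem_Iic.2 hle) (F.mem l)) _
  apply F.factor_nonzero l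
  -- As `F.g l = 0`, the identity of the last factor factors through `(obj l)⟦1⟧`. The phases there
  -- exceed that of the factor, so the identity vanishes and the factor would be zero.
  obtain ⟨k, hk⟩ := exists_mor₃_comp_of_distTriang (F.triangle l) (𝟙 (F.factor l))
    (by rw [hg, zero_comp])
  have hobj : σ.interval (Set.Ioi (F.phase l)) (F.obj l.castSucc) :=
    F.obj_mem ⟨_, Set.mem_Ioi.2 (lt_add_one _)⟩ _ fun i hi =>
      F.strictAnti (by simpa using hi)
  have hk0 : k = 0 :=
    StabilityCondition.interval_hom_eq_zero (I := Set.Ioi (F.phase l)) (J := Set.Iic (F.phase l))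
      (fun _ hx _ hy => lt_of_le_of_lt hy hx)
      (StabilityCondition.interval_shift 1 (fun φ hφ => by
        simp only [Set.mem_Ioi, Int.cast_one] at hφ ⊢; linarith) hobj)
      (StabilityCondition.interval_of_P (Set.mem_Iic.2 le_rfl) (F.mem l)) k
  rw [IsZero.iff_id_eq_zero]
  rw [hk0, comp_zero] at hk
  exact hk

variable [IsTriangulated C]

/-- Climb the filtration. While the phases exceed `a`, the whole object is the upper part.
Afterwards the upper part stays fixed, and the octahedron makes the new lower part an extension of
the next factor by the old one. Carrying `I` along records that truncation creates no new phases. -/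
lemma exists_triangle_obj (a : ℝ) (hI : ∀ i, F.phase i ∈ I) (h₁ : (I ∩ Set.Ioi a).Nonempty)
    (h₂ : (I ∩ Set.Iic a).Nonempty) (j : Fin (F.n + 2)) :
    ∃ (X Y : C) (f : X ⟶ F.obj j) (g : F.obj j ⟶ Y) (h : Y ⟶ X⟦(1 : ℤ)⟧),
      Triangle.mk f g h ∈ distTriang C ∧ σ.interval (I ∩ Set.Ioi a) X ∧
        σ.interval (I ∩ Set.Iic a) Y := by
  induction j using Fin.induction with
  | zero =>
    exact ⟨_, _, _, _, _, contractible_distinguished _,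
      StabilityCondition.interval_of_isZero h₁ F.isZero_obj_zero,
      StabilityCondition.interval_of_isZero h₂ (isZero_zero C)⟩
  | succ j ih =>
    by_cases hj : a < F.phase j
    · have hmem : σ.interval (I ∩ Set.Ioi a) (F.obj j.succ) := F.obj_mem h₁ _ fun i hi =>
        Set.mem_inter (hI i) (hj.trans_le (F.strictAnti.antitone (Fin.castSucc_lt_succ_iff.1 hi)))
      exact ⟨_, _, _, _, _, contractible_distinguished _, hmem,
        StabilityCondition.interval_of_isZero h₂ (isZero_zero C)⟩
    · obtain ⟨X, Y, f, g, h, hT, hX, hY⟩ := ih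
      obtain ⟨Y', g', h', hT'⟩ := distinguished_cocone_triangle (f ≫ F.f j)
      refine ⟨X, Y', _, g', h', hT', hX, ?_⟩
      have O := someOctahedron rfl hT (F.triangle j) hT'
      exact StabilityCondition.interval_obj₂ _ O.mem hY
        (StabilityCondition.interval_of_P (Set.mem_inter (hI j) (Set.mem_Iic.2 (not_lt.1 hj))) (F.mem j))

lemma exists_triangle (a : ℝ) (hI : ∀ i, F.phase i ∈ I) (h₁ : (I ∩ Set.Ioi a).Nonempty)
    (h₂ : (I ∩ Set.Iic a).Nonempty) :
    ∃ (X Y : C) (f : X ⟶ c) (g : c ⟶ Y) (h : Y ⟶ X⟦(1 : ℤ)⟧),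
      Triangle.mk f g h ∈ distTriang C ∧ σ.interval (I ∩ Set.Ioi a) X ∧
        σ.interval (I ∩ Set.Iic a) Y := by
  obtain ⟨X, Y, f, g, h, hT, hX, hY⟩ := F.exists_triangle_obj a hI h₁ h₂ (Fin.last _)
  refine ⟨X, Y, f ≫ F.isoLast.hom, F.isoLast.inv ≫ g, h, ?_, hX, hY⟩
  exact isomorphic_distinguished _ hT _
    (Triangle.isoMk _ _ (Iso.refl X) F.isoLast.symm (Iso.refl Y)
      (show (f ≫ F.isoLast.hom) ≫ F.isoLast.inv = 𝟙 X ≫ f by simp)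
      (show (F.isoLast.inv ≫ g) ≫ 𝟙 Y = F.isoLast.inv ≫ g by simp)
      (show h ≫ (𝟙 X)⟦(1 : ℤ)⟧' = 𝟙 Y ≫ h by simp))

end HNFiltration

/-! ### The t-structures of a stability condition -/

namespace StabilityCondition

variable [IsTriangulated C] (σ : StabilityCondition C)

/-- The t-structure with aisle `P((a, ∞))`. -/
def tStructure (a : ℝ) : TStructure C where
  -- The shift by 1 raises phases by 1 and lowers the degree by 1, hence the sign of `n`.
  le n := σ.interval (Set.Ioi (a - n))
  ge n := σ.interval (Set.Iic (a + 1 - n))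
  le_shift n b n' h X hX := by
    obtain rfl : n = b + n' := h.symm
    refine interval_shift b (fun φ hφ => ?_) hX
    simp only [Set.mem_Ioi, Int.cast_add] at hφ ⊢
    linarith
  ge_shift n b n' h X hX := by
    obtain rfl : n = b + n' := h.symm
    refine interval_shift b (fun φ hφ => ?_) hX
    simp only [Set.mem_Iic, Int.cast_add] at hφ ⊢
    linarith
  zero' X Y f hX hY := by
    refine interval_hom_eq_zero (fun x hx y hy => ?_) hX hY f
    simp only [Set.mem_Ioi, Set.mem_Iic, Int.cast_zero, Int.cast_one] at hx hy
    linarith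
  le_zero_le := interval_mono (Set.Ioi_subset_Ioi (by simp))
  ge_one_le := interval_mono (Set.Iic_subset_Iic.2 (by simp))
  exists_triangle_zero_one A := by
    by_cases hA : IsZero A
    · exact ⟨A, 0, interval_of_isZero Set.nonempty_Ioi hA,
        interval_of_isZero Set.nonempty_Iic (isZero_zero C), _, _, _, contractible_distinguished A⟩
    · obtain ⟨X, Y, f, g, h, hT, hX, hY⟩ := (σ.hn A hA).exists_triangle (I := Set.univ) a
        (fun _ => Set.mem_univ _) (by simp) (by simp)
      refine ⟨X, Y, interval_mono ?_ _ hX, interval_mono ?_ _ hY, f, g, h, hT⟩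
      · simp
      · simp

variable {σ}

@[simp]
lemma tStructure_le_zero (a : ℝ) : (σ.tStructure a).le 0 = σ.interval (Set.Ioi a) := by
  simp [tStructure]

/-- An object with phases above `a` that also lies in `P((-∞, a + 1])` receives no nonzero map from
its part of phase above `a + 1`; that part must vanish, leaving the part with phases in `(a, a +
1]`. -/
lemma tStructure_heart (a : ℝ) : (σ.tStructure a).heart = σ.interval (Set.Ioc a (a + 1)) := by
  have hle : (σ.tStructure a).heart =
      σ.interval (Set.Ioi a) ⊓ σ.interval (Set.Iic (a + 1)) := by
    simp [TStructure.heart, tStructure]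
  rw [hle]
  refine le_antisymm ?_ (le_inf (interval_mono Set.Ioc_subset_Ioi_self)
    (interval_mono Set.Ioc_subset_Iic_self))
  rintro c ⟨hc, hc'⟩
  have hne : (Set.Ioc a (a + 1)).Nonempty := Set.nonempty_Ioc.2 (lt_add_one a)
  by_cases h0 : IsZero c
  · exact interval_of_isZero hne h0
  obtain ⟨X, Y, f, g, h, hT, hX, hY⟩ := (σ.hn c h0).exists_triangle (I := Set.Ioi a) (a + 1)
    (fun i => (σ.hn c h0).lt_phase hc i)
    ⟨a + 2, by simp⟩ (by simp [Set.Ioi_inter_Iic])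
  have hf : f = 0 := interval_hom_eq_zero (I := Set.Ioi a ∩ Set.Ioi (a + 1))
    (fun _ hx _ hy => lt_of_le_of_lt hy hx.2) hX hc' f
  have hX0 : IsZero (X⟦(1 : ℤ)⟧) := by
    -- Since `f = 0`, the identity of `X⟦1⟧` factors through `Y`, whose phases are too small to
    -- receive a nonzero map.
    obtain ⟨k, hk⟩ := exists_comp_mor₃_of_distTriang hT (𝟙 (X⟦(1 : ℤ)⟧)) (by simp [hf])
    have hk0 : k = 0 := by
      refine interval_hom_eq_zero (I := Set.Ioi (a + 1)) (fun _ hx _ hy => lt_of_le_of_lt hy.2 hx)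
        (interval_shift 1 (fun φ hφ => ?_) hX) hY k
      have := hφ.2
      simp only [Set.mem_Ioi, Int.cast_one] at this ⊢
      linarith
    rw [IsZero.iff_id_eq_zero]
    rw [hk0, zero_comp] at hk
    exact hk
  have hX0' : IsZero X := (IsZero.iff_id_eq_zero X).2 <|
    (Functor.map_eq_zero_iff (shiftFunctor C (1 : ℤ))).1 (hX0.eq_of_src _ _)
  have : IsIso g := (Triangle.isZero₁_iff_isIso₂ _ hT).1 hX0'
  exact (σ.interval _).prop_of_iso (asIso g).symm hY

end StabilityCondition

/-! ### Tilting between nested aisles -/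

section Tilt

/-- A distinguished triangle with vertices in the heart of a t-structure is a short exact sequence
of the heart. -/
lemma shortExact_of_distTriang (s : TStructure C) {X Y Z : s.heart.FullSubcategory}
    (f : X ⟶ Y) (g : Y ⟶ Z) (w : f ≫ g = 0) (h : Z.obj ⟶ X.obj⟦(1 : ℤ)⟧)
    (hT : Triangle.mk f.hom g.hom h ∈ distTriang C) : (ShortComplex.mk f g w).ShortExact := by
  have hle (A : s.heart.FullSubcategory) : s.IsLE A.obj 0 := ⟨A.property.1⟩
  have hge (A : s.heart.FullSubcategory) : s.IsGE A.obj 0 := ⟨A.property.2⟩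
  have hmono : Mono f := by
    rw [Preadditive.mono_iff_cancel_zero]
    intro A k hk
    -- A map killed by `f` factors through `Z⟦-1⟧`, which lies in degrees at least 1.
    obtain ⟨l, m, hl⟩ := exists_comp_shift_of_distTriang hT k.hom
      (congrArg (fun q => q.hom) hk)
    have := s.isGE_shift Z.obj 0 (-1) 1
    rw [s.zero l 0 1, zero_comp] at hl
    exact ObjectProperty.hom_ext _ hl
  have hepi : Epi g := by
    rw [Preadditive.epi_iff_cancel_zero]
    intro A k hk
    obtain ⟨l, hl⟩ := exists_mor₃_comp_of_distTriang hT k.hom (congrArg (fun q => q.hom) hk)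
    have := s.isLE_shift X.obj 0 1 (-1)
    rw [s.zero l (-1) 0, comp_zero] at hl
    exact ObjectProperty.hom_ext _ hl
  have hker (A : s.heart.FullSubcategory) (k : A ⟶ Y) (hk : k ≫ g = 0) : ∃ l, l ≫ f = k := by
    obtain ⟨l, hl⟩ := exists_comp_mor₁_of_distTriang hT k.hom (congrArg (fun q => q.hom) hk)
    exact ⟨⟨l⟩, ObjectProperty.hom_ext _ hl.symm⟩
  have hcok (A : s.heart.FullSubcategory) (k : Y ⟶ A) (hk : f ≫ k = 0) : ∃ l, g ≫ l = k := by
    obtain ⟨l, hl⟩ := exists_mor₂_comp_of_distTriang hT k.hom (congrArg (fun q => q.hom) hk)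
    exact ⟨⟨l⟩, ObjectProperty.hom_ext _ hl.symm⟩
  let O : s.heart.FullSubcategory :=
    ⟨0, (s.isLE_of_isZero (isZero_zero C) 0).le, (s.isGE_of_isZero (isZero_zero C) 0).ge⟩
  have hO : IsZero O := by
    rw [IsZero.iff_id_eq_zero]
    exact ObjectProperty.hom_ext _ ((isZero_zero C).eq_of_src _ _)
  let hi : IsLimit (KernelFork.ofι f w) := KernelFork.IsLimit.ofι _ _
    (fun k hk => (hker _ k hk).choose) (fun k hk => (hker _ k hk).choose_spec)
    (fun k hk m hm => by rw [← cancel_mono f, hm, (hker _ k hk).choose_spec])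
  let hp : IsColimit (CokernelCofork.ofπ g w) := CokernelCofork.IsColimit.ofπ _ _
    (fun k hk => (hcok _ k hk).choose) (fun k hk => (hcok _ k hk).choose_spec)
    (fun k hk m hm => by rw [← cancel_epi g, hm, (hcok _ k hk).choose_spec])
  have hlift : hi.lift (KernelFork.ofι f w) = 𝟙 X :=
    (cancel_mono f).1 ((hi.fac _ WalkingParallelPair.zero).trans (Category.id_comp f).symm)
  have hdesc : hp.desc (CokernelCofork.ofπ g w) = 𝟙 Z :=
    (cancel_epi g).1 ((hp.fac _ WalkingParallelPair.one).trans (Category.comp_id g).symm)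
  have wπ : hi.lift (KernelFork.ofι f w) ≫ (0 : X ⟶ O) = 0 := comp_zero
  have wι : (0 : O ⟶ Z) ≫ hp.desc (CokernelCofork.ofπ g w) = 0 := zero_comp
  have hπ : IsColimit (CokernelCofork.ofπ 0 wπ) :=
    CokernelCofork.IsColimit.ofEpiOfIsZero _ (by rw [hlift]; exact inferInstanceAs (Epi (𝟙 X))) hO
  have hι : IsLimit (KernelFork.ofι 0 wι) :=
    KernelFork.IsLimit.ofMonoOfIsZero _ (by rw [hdesc]; exact inferInstanceAs (Mono (𝟙 Z))) hO
  -- `X` is the kernel and `Z` the cokernel, so the comparison maps are identities and the homology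
  -- is the zero object `O`.
  let data : (ShortComplex.mk f g w).HomologyData :=
    { left := ⟨X, O, f, 0, w, hi, wπ, hπ⟩
      right := ⟨Z, O, g, 0, w, hp, wι, hι⟩
      iso := Iso.refl O
      comm := by simp [w] }
  exact
    { exact := ⟨data, hO⟩
      mono_f := hmono
      epi_g := hepi }

lemma isLE_obj₃ (s : TStructure C) (T : Triangle C) (hT : T ∈ distTriang C) (n : ℤ)
    (h₁ : s.IsLE T.obj₁ (n + 1)) (h₂ : s.IsLE T.obj₂ n) : s.IsLE T.obj₃ n :=
  s.isLE₂ _ (rot_of_distTriang _ hT) n h₂ (s.isLE_shift T.obj₁ (n + 1) 1 n)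

lemma isGE_obj₁ (s : TStructure C) (T : Triangle C) (hT : T ∈ distTriang C) (m n : ℤ)
    (hmn : m + 1 = n) (h₂ : s.IsGE T.obj₂ n) (h₃ : s.IsGE T.obj₃ m) : s.IsGE T.obj₁ n :=
  s.isGE₂ _ (inv_rot_of_distTriang _ hT) n (s.isGE_shift T.obj₃ m (-1) n) h₂

variable {s u : TStructure C}

lemma le_le_of_le_zero_le {k : ℤ} (h : s.le 0 ≤ u.le k) (n : ℤ) : s.le n ≤ u.le (n + k) := by
  rw [← s.shift_le n 0 n (by simp), ← u.shift_le n k (n + k) rfl]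
  exact fun X hX => h _ hX

/-- Coaisles are right orthogonals of aisles, so inclusions reverse. -/
lemma ge_le_of_le_zero_le (h : s.le 0 ≤ u.le 0) (n : ℤ) : u.ge n ≤ s.ge n := by
  intro X hX
  have : u.IsGE X n := ⟨hX⟩
  refine ((s.isGE_iff_orthogonal (n - 1) n (by lia) X).2 fun Y f hY => ?_).ge
  have : u.IsLE Y (n - 1) := ⟨by simpa using le_le_of_le_zero_le h (n - 1) _ hY.le⟩
  exact u.zero f (n - 1) n

/-- Truncate an object of the heart of `s` with respect to `u`. One bound on each piece comes from
the nested aisles, the other from rotating the triangle, so both pieces stay in the heart. -/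
lemma isTorsionTheory_of_le (h₁ : s.le 0 ≤ u.le 0) (h₂ : u.le 0 ≤ s.le 1) :
    IsTorsionTheory s.heart (s.heart ⊓ u.le (-1)) (s.heart ⊓ u.ge 0) where
  torsion_le := inf_le_left
  free_le := inf_le_left
  torsion_iso := inferInstance
  free_iso := inferInstance
  hom_eq_zero x y hx hy f := by
    have : u.IsLE x (-1) := ⟨hx.2⟩
    have : u.IsGE y 0 := ⟨hy.2⟩
    exact u.zero f (-1) 0
  exists_shortExact a := by
    obtain ⟨x, y, hx, hy, f, g, h, hT⟩ := u.exists_triangle a.obj (-1) 0 (by lia)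
    have hxle : s.IsLE x 0 := ⟨by simpa using le_le_of_le_zero_le h₂ (-1) _ hx⟩
    have hyge : s.IsGE y 0 := ⟨ge_le_of_le_zero_le h₁ 0 _ hy⟩
    have hyle : s.IsLE y 0 := isLE_obj₃ s _ hT 0 (s.isLE_of_le x 0 1) ⟨a.property.1⟩
    have hxge : s.IsGE x 0 := isGE_obj₁ s _ hT (-1) 0 (by lia) ⟨a.property.2⟩
      (s.isGE_of_ge y (-1) 0)
    have hxh : s.heart x := ⟨hxle.le, hxge.ge⟩
    have hyh : s.heart y := ⟨hyle.le, hyge.ge⟩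
    have w : f ≫ g = 0 := comp_distTriang_mor_zero₁₂ _ hT
    exact ⟨⟨x, hxh⟩, ⟨y, hyh⟩, ⟨f⟩, ⟨g⟩, by ext; exact w, ⟨hxh, hx⟩, ⟨hyh, hy⟩,
      shortExact_of_distTriang s _ _ _ h hT⟩

/-- Truncate `c` in `u.le 0` with respect to `s`: the quotient lies in `s`-degree exactly 1 and in
`u.le 0`, so it belongs to the torsion class shifted by `[-1]`. -/
lemma le_zero_eq_extClosure (h₁ : s.le 0 ≤ u.le 0) (h₂ : u.le 0 ≤ s.le 1) :
    u.le 0 = extClosure (s.le 0 ⊔ (s.heart ⊓ u.le (-1)).shift (1 : ℤ)) := by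
  apply le_antisymm
  · intro c hc
    have hc' : s.IsLE c 1 := ⟨h₂ _ hc⟩
    obtain ⟨x, y, hx, hy, f, g, h, hT⟩ := s.exists_triangle_zero_one c
    have hx' : s.IsLE x 0 := ⟨hx⟩
    have hy' : s.IsGE y 1 := ⟨hy⟩
    have hxu : u.IsLE x 0 := ⟨h₁ _ hx⟩
    have hys : s.IsLE y 1 := isLE_obj₃ s _ hT 1 (s.isLE_of_le x 0 2) hc'
    have hyu : u.IsLE y 0 := isLE_obj₃ u _ hT 0 (u.isLE_of_le x 0 1) ⟨hc⟩
    refine .ext _ _ _ f g h hT (.of _ (.inl hx)) (.of _ (.inr ⟨⟨?_, ?_⟩, ?_⟩))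
    · exact (s.isLE_shift y 1 1 0).le
    · exact (s.isGE_shift y 1 1 0).ge
    · exact (u.isLE_shift y 0 1 (-1)).le
  · refine extClosure_le (sup_le h₁ ?_) fun T hT hX hZ => (u.isLE₂ T hT 0 ⟨hX⟩ ⟨hZ⟩).le
    rw [← u.shift_le 1 (-1) 0 (by lia)]
    exact fun X hX => hX.2

lemma isLeftTilt_of_le (h₁ : s.le 0 ≤ u.le 0) (h₂ : u.le 0 ≤ s.le 1) : IsLeftTilt s u :=
  ⟨_, _, isTorsionTheory_of_le h₁ h₂, le_zero_eq_extClosure h₁ h₂⟩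

lemma isRightTilt_of_le {t : TStructure C} (hut : u.le 0 = t.le 1) (h₁ : s.le 0 ≤ u.le 0)
    (h₂ : u.le 0 ≤ s.le 1) : IsRightTilt s t := by
  refine ⟨_, _, isTorsionTheory_of_le h₁ h₂, ?_⟩
  rw [← le_zero_eq_extClosure h₁ h₂, hut, t.shift_le (-1) 1 0 (by lia)]

end Tilt

/-! ### Nearby stability conditions -/

variable {σ τ : StabilityCondition C}

lemma abs_phiMinus_sub_le_of_genDist_le {ε : ℝ} (hε : 0 ≤ ε)
    (h : genDist σ τ ≤ ENNReal.ofReal ε) (c : C) (hc : ¬ IsZero c) :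
    |σ.phiMinus c hc - τ.phiMinus c hc| ≤ ε := by
  have h' : ENNReal.ofReal (distAt σ τ c hc) ≤ ENNReal.ofReal ε :=
    (le_iSup₂ (f := fun c hc => ENNReal.ofReal (distAt σ τ c hc)) c hc).trans h
  rw [ENNReal.ofReal_le_ofReal_iff hε] at h'
  exact ((le_max_left _ _).trans (le_max_left _ _)).trans h'

/-- For nonzero objects, membership in `P((a, ∞))` means that the minimal phase exceeds `a`, and
that phase moves by at most `ε`. -/
lemma interval_Ioi_le_of_genDist_le {ε : ℝ} (hε : 0 ≤ ε) (h : genDist σ τ ≤ ENNReal.ofReal ε)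
    {a b : ℝ} (hab : b + ε ≤ a) : σ.interval (Set.Ioi a) ≤ τ.interval (Set.Ioi b) := by
  intro c hc
  by_cases h0 : IsZero c
  · exact StabilityCondition.interval_of_isZero Set.nonempty_Ioi h0
  · refine (τ.hn c h0).interval_of_phase_mem fun i => ?_
    have h₁ : a < σ.phiMinus c h0 := (σ.hn c h0).lt_phase hc _
    have h₂ : τ.phiMinus c h0 ≤ (τ.hn c h0).phase i :=
      (τ.hn c h0).strictAnti.antitone (Fin.le_last i)
    have h₃ := (abs_le.1 (abs_phiMinus_sub_le_of_genDist_le hε h c h0)).2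
    simp only [Set.mem_Ioi]
    linarith

lemma genDist_comm (σ τ : StabilityCondition C) : genDist σ τ = genDist τ σ := by
  simp only [genDist, distAt_comm σ τ]

variable [IsTriangulated C]

/-- The aisles of two stability conditions at distance at most `1 / 2` are related by a left tilt
followed by a right tilt. -/
lemma reflTransGen_tilt_of_genDist_le (h : genDist σ τ ≤ ENNReal.ofReal (1 / 2)) :
    Relation.ReflTransGen (fun a b => IsLeftTilt a b ∨ IsRightTilt a b)
      (σ.tStructure 0) (τ.tStructure 0) := by
  have hle (υ : StabilityCondition C) (a : ℝ) (n : ℤ) :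
      (υ.tStructure a).le n = υ.interval (Set.Ioi (a - n)) := rfl
  -- The cut `-1 / 2` leaves a margin of 1/2 on both sides: the τ-aisle cut at `-1` lies between the
  -- σ-aisles cut at `-1 / 2` and `-3 / 2`. Its shift by `[1]` is the τ-aisle cut at `0`.
  refine .tail (.single (b := σ.tStructure (-1 / 2)) (.inl (isLeftTilt_of_le ?_ ?_)))
    (.inr (isRightTilt_of_le (u := τ.tStructure (-1)) ?_ ?_ ?_)) <;> simp only [hle]
  · exact StabilityCondition.interval_mono (Set.Ioi_subset_Ioi (by norm_num))
  · exact StabilityCondition.interval_mono (Set.Ioi_subset_Ioi (by norm_num))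
  · norm_num
  · exact interval_Ioi_le_of_genDist_le (by norm_num) h (by norm_num)
  · exact interval_Ioi_le_of_genDist_le (by norm_num) (genDist_comm σ τ ▸ h) (by norm_num)

end Bridgeland

end

theorem corollary5p2 {C : Type u} [Category.{v} C] [Preadditive C] [HasZeroObject C]
    [HasShift C ℤ] [∀ n : ℤ, (shiftFunctor C n).Additive] [Pretriangulated C] [IsTriangulated C]
    (σ τ : Bridgeland.Stab C) (hστ : τ ∈ connectedComponent σ) :
    ∃ s t : TStructure C,
      s.le 0 = σ.1.interval (Set.Ioi 0) ∧ s.heart = σ.1.heart ∧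
      t.le 0 = τ.1.interval (Set.Ioi 0) ∧ t.heart = τ.1.heart ∧
      Relation.ReflTransGen
        (fun a b => Bridgeland.IsLeftTilt a b ∨ Bridgeland.IsRightTilt a b) s t := by
  have hheart (υ : Bridgeland.StabilityCondition C) : (υ.tStructure 0).heart = υ.heart := by
    rw [Bridgeland.StabilityCondition.tStructure_heart, zero_add]
    rfl
  refine ⟨σ.1.tStructure 0, τ.1.tStructure 0, by simp, hheart _, by simp, hheart _, ?_⟩
  let S : Set (Bridgeland.Stab C) := {υ | Relation.ReflTransGen
    (fun a b => Bridgeland.IsLeftTilt a b ∨ Bridgeland.IsRightTilt a b)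
    (σ.1.tStructure 0) (υ.1.tStructure 0)}
  have hstep {υ ω : Bridgeland.Stab C} (hυ : υ ∈ S)
      (h : edist υ ω < ENNReal.ofReal (1 / 2)) : ω ∈ S :=
    Relation.ReflTransGen.trans hυ (Bridgeland.reflTransGen_tilt_of_genDist_le h.le)
  have hpos : 0 < ENNReal.ofReal (1 / 2) := by simp
  have hopen : IsOpen S := EMetric.isOpen_iff.2 fun υ hυ =>
    ⟨_, hpos, fun ω hω => hstep hυ (by rwa [edist_comm])⟩
  -- The radius 1/2 is uniform and the distance symmetric: a reachable point within 1/2 of `υ` would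
  -- make `υ` reachable.
  have hclosed : IsClosed S := ⟨EMetric.isOpen_iff.2 fun υ hυ =>
    ⟨_, hpos, fun ω hω hωS => hυ (hstep hωS hω)⟩⟩
  exact IsClopen.connectedComponent_subset ⟨hclosed, hopen⟩ Relation.ReflTransGen.refl hστ
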